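/- Let $X$ be a finite ground set and let $\Sigma$ be an implicational base on $X$, i.e. a finite set of implications $A \to B$ with $A, B \subseteq X$. A set $C \subseteq X$ is closed if $A \subseteq C$ implies $B \subseteq C$ for every $A \to B \in \Sigma$. For $x \in X$, let $\mathrm{irr}(x)$ be the family of inclusion-wise maximal closed sets not containing $x$. The implication graph of $\Sigma$ has an arc from $a$ to $b$ whenever $a \in A$ and $b \in B$ for some $A \to B \in \Sigma$; $\Sigma$ is acyclic if this directed graph has no directed cycle, and the ancestors of $x$ are the elements $y \neq x$ from which there is a directed path to $x$. The conclusion-degree of $\Sigma$ is $\max_{x \in X} |\{A \to B \in \Sigma : x \in B\}|$. The problem ACS+A-Enum is: given an acyclic implicational base $(X, \Sigma)$, an element $x \in X$, and the family $\mathrm{irr}(y)$ for every ancestor $y$ of $x$, list the members of $\mathrm{irr}(x)$ without repetition. The size of such an instance is $N = |X| + |\Sigma| + \big|\bigcup_{y} \mathrm{irr}(y)\big|$, the union being over the ancestors $y$ of $x$. Theorem. (1) There is an algorithm that solves ACS+A-Enum in total time $N^{O(k)}$ on inputs of size $N$ and conclusion-degree $k$; that is, there are one algorithm (not depending on $k$)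 and one constant $c$ such that the algorithm halts within $c \cdot N^{c \cdot \max(1,k)}$ steps on every input of size $N$ and conclusion-degree $k$. Here an algorithm is a program with assignments, conditionals and while-loops whose finitely many variables hold binary trees, with one time unit per elementary operation; elements are encoded in unary, sets by characteristic vectors, and families by lists in any order. (2) Let $(X, \Sigma)$ be an acyclic implicational base and $x \in X$, and let $\mathcal{H}_x$ be the hypergraph whose edges are the premises $A$ of the implications $A \to B \in \Sigma$ with $x \in B$ and whose vertex set is the union of these edges. For every $M \in \mathrm{irr}(x)$ there are an inclusion-wise minimal transversal $T$ of $\mathcal{H}_x$ and an irreducible selection $\mathcal{S}$ for $T$ (a family obtained by choosing one member of $\mathrm{irr}(t)$ for each $t \in T$) such that $M = \big(\bigcap \mathcal{S}\big) \setminus \{x\}$, where $\bigcap \emptyset = X$. -/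

import Mathlib

namespace ACG

section ImplicationalBases

/-- An implication `A → B` over `α`: the pair of its premise `A` and its conclusion `B`. -/
abbrev Implication (α : Type*) := Finset α × Finset α

/-- The premise of an implication. -/
abbrev Implication.premise {α : Type*} (i : Implication α) : Finset α := i.1

/-- The conclusion of an implication. -/
abbrev Implication.conclusion {α : Type*} (i : Implication α) : Finset α := i.2

/-- An implicational base whose ground set is the (finite) type `α`. -/
abbrev ImpBase (α : Type*) := Finset (Implication α)

variable {α : Type*}

/-- `C` is closed for `Γ`: it contains the conclusion of each implication whose premise
it contains. -/
def ClosedFor (Γ : ImpBase α) (C : Finset α) : Prop :=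
  ∀ i ∈ Γ, i.premise ⊆ C → i.conclusion ⊆ C

/-- The arcs of the implication graph of `Γ`. -/
def Arc (Γ : ImpBase α) (a b : α) : Prop :=
  ∃ i ∈ Γ, a ∈ i.premise ∧ b ∈ i.conclusion

/-- `Γ` is acyclic: its implication graph has no directed cycle (loops included). -/
def Acyclic (Γ : ImpBase α) : Prop :=
  ∀ a, ¬ Relation.TransGen (Arc Γ) a a

open Classical in
/-- The ancestors of `x`: the elements `y ≠ x` with a directed path from `y` to `x` in the
implication graph. -/
noncomputable def anc [Fintype α] (Γ : ImpBase α) (x : α) : Finset α :=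
  {y | y ≠ x ∧ Relation.ReflTransGen (Arc Γ) y x}

open Classical in
/-- `irr(x)`: the inclusion-wise maximal closed sets that do not contain `x`. -/
noncomputable def irr [Fintype α] (Γ : ImpBase α) (x : α) : Finset (Finset α) :=
  {M | Maximal (fun C => ClosedFor Γ C ∧ x ∉ C) M}

/-- The conclusion-degree of `x` in `Γ`. -/
def cdegAt [DecidableEq α] (Γ : ImpBase α) (x : α) : ℕ :=
  (Γ.filter fun i => x ∈ i.conclusion).card

/-- The (maximum) conclusion-degree of `Γ`. -/
def cdeg [Fintype α] [DecidableEq α] (Γ : ImpBase α) : ℕ :=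
  Finset.univ.sup (cdegAt Γ)

/-- The edges of the hypergraph of premises of `x`; its vertices are the members of the edges. -/
def premisesOf [DecidableEq α] (Γ : ImpBase α) (x : α) : Finset (Finset α) :=
  (Γ.filter fun i => x ∈ i.conclusion).image Implication.premise

/-- `T` is a transversal of the hypergraph with edge set `E` and vertex set `⋃ E`. -/
def IsTransversal [DecidableEq α] (E : Finset (Finset α)) (T : Finset α) : Prop :=
  T ⊆ E.biUnion id ∧ ∀ A ∈ E, (T ∩ A).Nonempty

/-- `T` is an inclusion-wise minimal transversal of the hypergraph with edge set `E`. -/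
def IsMinTransversal [DecidableEq α] (E : Finset (Finset α)) (T : Finset α) : Prop :=
  Minimal (IsTransversal E) T

/-- `S` is an irreducible selection for `T`: it is obtained by choosing one member of `irr(t)`
for each `t ∈ T`. -/
def IsSelection [Fintype α] [DecidableEq α] (Γ : ImpBase α) (T : Finset α)
    (S : Finset (Finset α)) : Prop :=
  ∃ f : α → Finset α, (∀ t ∈ T, f t ∈ irr Γ t) ∧ S = T.image f

/-- The intersection of a family of subsets of the ground set (the whole ground set if the
family is empty). -/
def interFam [Fintype α] [DecidableEq α] (S : Finset (Finset α)) : Finset α :=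
  Finset.univ.filter fun a => ∀ M ∈ S, a ∈ M

/-- The size of the input made of the base `Γ`, the element `x`, and `irr(y)` for all ancestors
`y` of `x`: the number of elements of the ground set, plus the number of implications, plus
the number of given irreducible closed sets. -/
noncomputable def inputSize [Fintype α] [DecidableEq α] (Γ : ImpBase α) (x : α) : ℕ :=
  Fintype.card α + Γ.card + ((anc Γ x).biUnion (irr Γ)).card

end ImplicationalBases

/-! The machine model: imperative programs with loops whose variables hold binary trees
(pointers to immutable cells), with the usual unit-cost measure. -/

/-- Binary trees. -/
inductive Data : Type
  | nil : Data
  | cons : Data → Data → Data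

/-- The left component (`nil` for `nil`). -/
def Data.hd : Data → Data
  | .nil => .nil
  | .cons a _ => a

/-- The right component (`nil` for `nil`). -/
def Data.tl : Data → Data
  | .nil => .nil
  | .cons _ b => b

/-- Expressions over the variables `0, 1, 2, …`. -/
inductive Expr : Type
  | var : ℕ → Expr
  | nil : Expr
  | cons : Expr → Expr → Expr
  | hd : Expr → Expr
  | tl : Expr → Expr

/-- The values of the variables. -/
abbrev Store := ℕ → Data

/-- The value of an expression. -/
def Expr.eval (σ : Store) : Expr → Data
  | .var i => σ i
  | .nil => .nil
  | .cons e f => .cons (e.eval σ) (f.eval σ)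
  | .hd e => (e.eval σ).hd
  | .tl e => (e.eval σ).tl

/-- The cost of evaluating an expression: one unit for each variable, constant and operation. -/
def Expr.cost : Expr → ℕ
  | .var _ => 1
  | .nil => 1
  | .cons e f => e.cost + f.cost + 1
  | .hd e => e.cost + 1
  | .tl e => e.cost + 1

/-- Programs. Tests ask whether the value of an expression is different from `nil`. -/
inductive Prog : Type
  | skip : Prog
  | assign : ℕ → Expr → Prog
  | seq : Prog → Prog → Prog
  | cond : Expr → Prog → Prog → Prog
  | loop : Expr → Prog → Prog

/-- `Exec p σ t τ`: started in the store `σ`, the program `p` halts after exactly `t` time units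
in the store `τ`. -/
inductive Exec : Prog → Store → ℕ → Store → Prop
  | skip (σ : Store) : Exec .skip σ 1 σ
  | assign (i : ℕ) (e : Expr) (σ : Store) :
      Exec (.assign i e) σ (e.cost + 1) (Function.update σ i (e.eval σ))
  | seq {p q : Prog} {σ τ ρ : Store} {s t : ℕ} :
      Exec p σ s τ → Exec q τ t ρ → Exec (.seq p q) σ (s + t) ρ
  | condTrue {e : Expr} {p q : Prog} {σ τ : Store} {t : ℕ} :
      e.eval σ ≠ .nil → Exec p σ t τ → Exec (.cond e p q) σ (e.cost + 1 + t) τ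
  | condFalse {e : Expr} {p q : Prog} {σ τ : Store} {t : ℕ} :
      e.eval σ = .nil → Exec q σ t τ → Exec (.cond e p q) σ (e.cost + 1 + t) τ
  | loopStop {e : Expr} {p : Prog} {σ : Store} :
      e.eval σ = .nil → Exec (.loop e p) σ (e.cost + 1) σ
  | loopStep {e : Expr} {p : Prog} {σ τ ρ : Store} {s t : ℕ} :
      e.eval σ ≠ .nil → Exec p σ s τ → Exec (.loop e p) τ t ρ →
      Exec (.loop e p) σ (e.cost + 1 + s + t) ρ

/-- On input `d` (held by variable `0`, all other variables being `nil`), the program `p` halts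
after exactly `t` time units with output `o` (held by variable `0`). -/
def RunsTo (p : Prog) (d : Data) (t : ℕ) (o : Data) : Prop :=
  ∃ τ : Store, Exec p (Function.update (fun _ => Data.nil) 0 d) t τ ∧ τ 0 = o

/-! Encodings of instances and of outputs by binary trees. -/

/-- The encoding of a list of trees. -/
def Data.ofList : List Data → Data
  | [] => .nil
  | d :: l => .cons d (Data.ofList l)

/-- The encoding of a natural number, in unary. -/
def Data.ofNat (m : ℕ) : Data := Data.ofList (List.replicate m .nil)

/-- The encoding of a truth value. -/
def Data.ofBool : Bool → Data
  | false => .nil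
  | true => .cons .nil .nil

/-- The encoding of a subset of `{0, …, n - 1}` by its characteristic vector. -/
def Data.ofSet {n : ℕ} (S : Finset (Fin n)) : Data :=
  Data.ofList ((List.finRange n).map fun a => Data.ofBool (decide (a ∈ S)))

/-- The encoding of a list of subsets of `{0, …, n - 1}`. -/
def Data.ofSets {n : ℕ} (l : List (Finset (Fin n))) : Data :=
  Data.ofList (l.map Data.ofSet)

/-- The list `l` lists the members of the finite set `F`, in any order, without repetition. -/
def Lists {β : Type*} [DecidableEq β] (l : List β) (F : Finset β) : Prop :=
  l.Nodup ∧ l.toFinset = F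

/-- `d` encodes the instance that consists of the base `Γ` on the ground set `{0, …, n - 1}`, of
the element `x`, and of the families `irr(y)` for all ancestors `y` of `x`. The implications,
the ancestors, and the members of each family may come in any order. -/
def EncodesInput {n : ℕ} (Γ : ImpBase (Fin n)) (x : Fin n) (d : Data) : Prop :=
  ∃ (li : List (Implication (Fin n))) (la : List (Fin n × List (Finset (Fin n)))),
    Lists li Γ ∧
    Lists (la.map Prod.fst) (anc Γ x) ∧
    (∀ q ∈ la, Lists q.2 (irr Γ q.1)) ∧
    d = Data.ofList
      [ Data.ofNat n,
        Data.ofList (li.map fun i => .cons (Data.ofSet i.premise) (Data.ofSet i.conclusion)),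
        Data.ofNat x,
        Data.ofList (la.map fun q => .cons (Data.ofNat q.1) (Data.ofSets q.2)) ]

/-- `o` encodes a list, in any order and without repetition, of the members of `F`. -/
def EncodesFamily {n : ℕ} (F : Finset (Finset (Fin n))) (o : Data) : Prop :=
  ∃ l : List (Finset (Fin n)), Lists l F ∧ o = Data.ofSets l

/-- The program `p` solves the problem of enumerating `irr(x)`, given an acyclic implicational
base, an element `x`, and `irr(y)` for all ancestors `y` of `x`, in time at most `b N k` on inputs
of size `N` and maximum conclusion-degree `k`. -/
def SolvesWithin (p : Prog) (b : ℕ → ℕ → ℕ) : Prop :=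
  ∀ (n : ℕ) (Γ : ImpBase (Fin n)) (x : Fin n) (d : Data),
    Acyclic Γ → EncodesInput Γ x d →
      ∃ (t : ℕ) (o : Data), RunsTo p d t o ∧ EncodesFamily (irr Γ x) o ∧
        t ≤ b (inputSize Γ x) (cdeg Γ)

end ACG

namespace ACG

/-! ### Programs on finite stores -/

/-! Both statements rest on one observation. If `D` is closed and contains no premise of an
implication concluding `x`, then `D \ {x}` is closed (`closedFor_sdiff_singleton`). For (2), let `M
∈ irr(x)`. No premise of `x` lies in `M`, so some minimal transversal `T` is disjoint from `M`, and
`M` extends to a member of `irr(t)` for each `t ∈ T`. The intersection of these members is closed,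
contains `M` and contains no premise of `x`. Removing `x` from it gives a closed set avoiding `x`,
which equals `M` by maximality (`exists_selection_of_mem_irr`). For (1), minimal transversals need
not be computed. Start from `X \ {x}` and, for each implication concluding `x`, replace every
candidate `C` by all `C ∩ K` with `K ∈ irr(t)` and `t` in the premise. There are at most `N * N`
pairs `(t, K)`, so at most `(N * N) ^ k` candidates arise (`baseLoop_spec`). The final candidates
are closed and avoid `x` (`exists_closed_of_mem_candidates`), and every member of `irr(x)` lies in
one of them (`exists_superset_mem_candidates`). Hence the inclusion-maximal candidates are exactly
`irr(x)` (`lists_irr_of_maximal`). Acyclicity ensures that the families needed are part of the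
input. -/

/-- The store whose first variables hold the members of a list, the other ones being `nil`. -/
def storeOf (l : List Data) : Store := fun i => l.getD i .nil

theorem storeOf_zero (a : Data) (l : List Data) : storeOf (a :: l) 0 = a := rfl

theorem storeOf_succ (a : Data) (l : List Data) (i : ℕ) :
    storeOf (a :: l) (i + 1) = storeOf l i := rfl

theorem update_storeOf {l : List Data} {i : ℕ} (hi : i < l.length) (d : Data) :
    Function.update (storeOf l) i d = storeOf (l.set i d) := by
  funext j
  by_cases h : j = i
  · subst h
    simp [storeOf, List.getD_eq_getElem?_getD, hi]
  · simp [storeOf, Function.update_of_ne h, List.getD_eq_getElem?_getD, List.getElem?_set_ne (Ne.symm h)]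

/-- `p` halts within `b` time units. -/
def HaltsIn (p : Prog) (σ : Store) (b : ℕ) (τ : Store) : Prop :=
  ∃ t ≤ b, Exec p σ t τ

infixr:60 " ;; " => Prog.seq

namespace HaltsIn

variable {p q : Prog} {e : Expr} {σ τ ρ : Store} {a b : ℕ}

theorem mono (h : HaltsIn p σ a τ) (hab : a ≤ b) : HaltsIn p σ b τ :=
  let ⟨t, ht, hp⟩ := h
  ⟨t, ht.trans hab, hp⟩

theorem skip : HaltsIn .skip σ 1 σ := ⟨1, le_rfl, .skip σ⟩

theorem seq (hp : HaltsIn p σ a τ) (hq : HaltsIn q τ b ρ) : HaltsIn (p ;; q) σ (a + b) ρ :=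
  let ⟨s, hs, hp⟩ := hp
  let ⟨t, ht, hq⟩ := hq
  ⟨s + t, Nat.add_le_add hs ht, .seq hp hq⟩

theorem assign {l : List Data} {i : ℕ} (hi : i < l.length := by simp) :
    HaltsIn (.assign i e) (storeOf l) (e.cost + 1) (storeOf (l.set i (e.eval (storeOf l)))) :=
  ⟨_, le_rfl, update_storeOf hi _ ▸ Exec.assign i e (storeOf l)⟩

theorem condTrue (he : e.eval σ ≠ .nil) (h : HaltsIn p σ b τ) :
    HaltsIn (.cond e p q) σ (e.cost + 1 + b) τ :=
  let ⟨_, ht, h⟩ := h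
  ⟨_, Nat.add_le_add_left ht _, .condTrue he h⟩

theorem condFalse (he : e.eval σ = .nil) (h : HaltsIn q σ b τ) :
    HaltsIn (.cond e p q) σ (e.cost + 1 + b) τ :=
  let ⟨_, ht, h⟩ := h
  ⟨_, Nat.add_le_add_left ht _, .condFalse he h⟩

/-- A loop that consumes the list held by variable `i`, with an invariant `P`. -/
theorem loop_list {β γ : Type*} (enc : β → Data) (mk : List β → γ → Store) {i : ℕ}
    (P : List β → γ → Prop)
    (hmk : ∀ xs g, mk xs g i = Data.ofList (xs.map enc))
    (hbody : ∀ x xs g, P (x :: xs) g → ∃ g', HaltsIn p (mk (x :: xs) g) b (mk xs g') ∧ P xs g') :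
    ∀ xs g, P xs g → ∃ g', HaltsIn (.loop (.var i) p) (mk xs g) (xs.length * (b + 2) + 2)
      (mk [] g') ∧ P [] g'
  | [], g, h => ⟨g, ⟨2, by simp, .loopStop (by simpa [Expr.eval, Data.ofList] using hmk [] g)⟩, h⟩
  | x :: xs, g, h => by
    obtain ⟨g₁, ⟨s, hs, h₁⟩, hP⟩ := hbody x xs g h
    obtain ⟨g₂, ⟨t, ht, h₂⟩, hP₂⟩ := loop_list enc mk P hmk hbody xs g₁ hP
    refine ⟨g₂, ⟨_, ?_, .loopStep (by simp [Expr.eval, hmk, Data.ofList]) h₁ h₂⟩, hP₂⟩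
    -- A test of a variable costs 2: once for each turn, and once more for the final failing test.
    simp only [Expr.cost, List.length_cons, Nat.add_one_mul]
    omega

/-- The invariant is that folding the rest of the list over the current state still yields the final
result. -/
theorem loop_foldl {β γ : Type*} (enc : β → Data) (mk : List β → γ → Store) {i : ℕ}
    (f : γ → β → γ)
    (hmk : ∀ xs g, mk xs g i = Data.ofList (xs.map enc))
    (hbody : ∀ x xs g, HaltsIn p (mk (x :: xs) g) b (mk xs (f g x))) (xs : List β) (g : γ) :
    HaltsIn (.loop (.var i) p) (mk xs g) (xs.length * (b + 2) + 2) (mk [] (xs.foldl f g)) := by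
  obtain ⟨g', h, hg'⟩ := loop_list enc mk (fun ys g' => ys.foldl f g' = xs.foldl f g) hmk
    (fun x ys g' h => ⟨_, hbody x ys g', h⟩) xs g rfl
  rw [← hg']
  exact h

/-- A loop that consumes a list and pushes items onto an accumulator. -/
theorem loop_append {β δ : Type*} (enc : β → Data) (mk : List β → List δ → Store) {i : ℕ}
    (f : β → List δ) (xs : List β)
    (hmk : ∀ xs g, mk xs g i = Data.ofList (xs.map enc))
    (hbody : ∀ x ∈ xs, ∀ ys g, HaltsIn p (mk (x :: ys) g) b (mk ys (f x ++ g))) (g : List δ) :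
    HaltsIn (.loop (.var i) p) (mk xs g) (xs.length * (b + 2) + 2)
      (mk [] (xs.reverse.flatMap f ++ g)) := by
  -- Items are pushed at the front, which reverses their order. The part `ys ⊆ xs` of the invariant
  -- restricts the demand on the body to members of `xs`.
  obtain ⟨g', h, hg', -⟩ := loop_list (p := p) (b := b) enc mk
    (fun ys g' => ys.reverse.flatMap f ++ g' = xs.reverse.flatMap f ++ g ∧ ys ⊆ xs) hmk
    (fun x ys g' h => ⟨_, hbody x (h.2 (by simp)) ys g', by simpa using h.1,
      fun _ hz => h.2 (by simp [hz])⟩) xs g ⟨rfl, fun _ h => h⟩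
  rw [← hg']
  simpa using h

end HaltsIn

/-! ### Subroutines on characteristic vectors -/

/-- Variable `2` becomes the entry of the vector in variable `1` whose index is in variable `0`. -/
def memberProg : Prog :=
  .loop (.var 0) (.assign 0 (.tl (.var 0)) ;; .assign 1 (.tl (.var 1))) ;;
  .assign 2 (.hd (.var 1)) ;; .assign 1 .nil

/-- Variable `3` becomes the conjunction of the vectors in the variables `0` and `1`. -/
def interProg : Prog :=
  .assign 2 .nil ;;
  .loop (.var 0)
    (.cond (.hd (.var 0)) (.assign 2 (.cons (.hd (.var 1)) (.var 2)))
      (.assign 2 (.cons .nil (.var 2))) ;;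
    .assign 0 (.tl (.var 0)) ;; .assign 1 (.tl (.var 1))) ;;
  .assign 3 .nil ;;
  .loop (.var 2) (.assign 3 (.cons (.hd (.var 2)) (.var 3)) ;; .assign 2 (.tl (.var 2)))

/-- Variable `2` tells whether the vector in variable `0` is at most the one in variable `1`. -/
def subsetProg : Prog :=
  .assign 2 (.cons .nil .nil) ;;
  .loop (.var 0)
    (.cond (.hd (.var 0)) (.cond (.hd (.var 1)) .skip (.assign 2 .nil)) .skip ;;
    .assign 0 (.tl (.var 0)) ;; .assign 1 (.tl (.var 1)))

theorem hd_foldl_tl : ∀ (m : ℕ) (l : List Data), m < l.length →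
    ((List.replicate m Data.nil).foldl (fun v _ => v.tl) (Data.ofList l)).hd = l.getD m .nil
  | 0, a :: l, _ => rfl
  | m + 1, a :: l, h => by
    simpa [List.replicate_succ, Data.ofList, Data.tl] using
      hd_foldl_tl m l (by simpa using h)

/-- The subroutines leave their scratch variables `nil`, so that stores keep one fixed shape between
calls. -/
theorem memberProg_spec {n : ℕ} (a : Fin n) (A : Finset (Fin n)) (w : Data) (r : List Data) :
    HaltsIn memberProg (storeOf (Data.ofNat a :: Data.ofSet A :: w :: r)) (8 * n + 7)
      (storeOf (.nil :: .nil :: Data.ofBool (decide (a ∈ A)) :: r)) := by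
  have h := HaltsIn.loop_foldl (i := 0) (b := 6)
    (p := .assign 0 (.tl (.var 0)) ;; .assign 1 (.tl (.var 1))) id
    (fun xs (v : Data) => storeOf (Data.ofList xs :: v :: w :: r)) (fun v _ => v.tl)
    (by simp [storeOf_zero]) (fun x xs g => .seq .assign .assign)
    (List.replicate a .nil) (Data.ofSet A)
  have e : ((List.replicate a Data.nil).foldl (fun v _ => v.tl) (Data.ofSet A)).hd =
      Data.ofBool (decide (a ∈ A)) := by
    rw [Data.ofSet, hd_foldl_tl _ _ (by simp)]
    simp [List.getD_eq_getElem?_getD]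
  rw [← e]
  refine .mono (.seq h (.seq .assign .assign)) ?_
  simp only [List.length_replicate, Expr.cost]
  omega

theorem interProg_spec {n : ℕ} (A B : Finset (Fin n)) (w z : Data) (r : List Data) :
    HaltsIn interProg (storeOf (Data.ofSet A :: Data.ofSet B :: w :: z :: r)) (26 * n + 8)
      (storeOf (.nil :: .nil :: .nil :: Data.ofSet (A ∩ B) :: r)) := by
  have h₁ := HaltsIn.loop_foldl (i := 0) (b := 14)
    (p := .cond (.hd (.var 0)) (.assign 2 (.cons (.hd (.var 1)) (.var 2)))
      (.assign 2 (.cons .nil (.var 2))) ;;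
      .assign 0 (.tl (.var 0)) ;; .assign 1 (.tl (.var 1))) Data.ofBool
    (fun xs (g : List Bool × List Bool) => storeOf (Data.ofList (xs.map .ofBool) ::
      Data.ofList (g.1.map .ofBool) :: Data.ofList (g.2.map .ofBool) :: z :: r))
    -- The default `false` mirrors `Data.hd` on `nil`: the body matches the fold even when the
    -- second vector is exhausted.
    (fun g b => (g.1.tail, (b && g.1.headD false) :: g.2))
    (by simp [storeOf_zero]) (by
      rintro (_ | _) xs ⟨_ | ⟨c, g⟩, k⟩
      · exact .mono (.seq (.condFalse rfl .assign) (.seq .assign .assign)) (by decide)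
      · exact .mono (.seq (.condFalse rfl .assign) (.seq .assign .assign)) (by decide)
      · exact .mono (.seq (.condTrue (fun h => nomatch h) .assign) (.seq .assign .assign)) (by decide)
      · exact .mono (.seq (.condTrue (fun h => nomatch h) .assign) (.seq .assign .assign)) (by decide))
    ((List.finRange n).map fun a => decide (a ∈ A)) ((List.finRange n).map fun a => decide (a ∈ B), [])
  -- The first loop builds the conjunction in reverse; this one restores the order.
  have h₂ := HaltsIn.loop_foldl (i := 2) (b := 8)
    (p := .assign 3 (.cons (.hd (.var 2)) (.var 3)) ;; .assign 2 (.tl (.var 2))) Data.ofBool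
    (fun xs (g : List Bool) => storeOf (Data.nil :: Data.nil :: Data.ofList (xs.map .ofBool) ::
      Data.ofList (g.map .ofBool) :: r)) (fun g b => b :: g)
    (fun _ _ => rfl) (fun _ _ _ => .seq .assign .assign)
    ((List.finRange n).map fun a => decide (a ∈ A ∩ B)).reverse []
  have e : ∀ l : List (Fin n), ∀ k, (l.map fun a => decide (a ∈ A)).foldl
      (fun (g : List Bool × List Bool) b => (g.1.tail, (b && g.1.headD false) :: g.2))
      (l.map fun a => decide (a ∈ B), k) =
      ([], (l.map fun a => decide (a ∈ A ∩ B)).reverse ++ k) := by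
    intro l
    induction l with
    | nil => simp
    | cons a l ih =>
      intro k
      simp only [List.map_cons, List.foldl_cons, List.tail_cons, List.headD_cons, ih]
      simp
  rw [e, List.append_nil] at h₁
  rw [List.foldl_flip_cons_eq_append'] at h₂
  simp only [List.map_map, List.length_map, List.length_finRange, List.reverse_reverse,
    List.append_nil, List.length_reverse] at h₁ h₂
  refine .mono (.seq .assign (.seq h₁ (.seq .assign h₂))) ?_
  simp only [Expr.cost]
  omega

theorem subsetProg_spec {n : ℕ} (A B : Finset (Fin n)) (w : Data) (r : List Data) :
    HaltsIn subsetProg (storeOf (Data.ofSet A :: Data.ofSet B :: w :: r)) (16 * n + 6)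
      (storeOf (.nil :: .nil :: Data.ofBool (decide (A ⊆ B)) :: r)) := by
  have h := HaltsIn.loop_foldl (i := 0) (b := 14)
    (p := .cond (.hd (.var 0)) (.cond (.hd (.var 1)) .skip (.assign 2 .nil)) .skip ;;
      .assign 0 (.tl (.var 0)) ;; .assign 1 (.tl (.var 1))) Data.ofBool
    (fun xs (g : List Bool × Bool) => storeOf (Data.ofList (xs.map .ofBool) ::
      Data.ofList (g.1.map .ofBool) :: Data.ofBool g.2 :: r))
    (fun g b => (g.1.tail, g.2 && (!b || g.1.headD false)))
    (by simp [storeOf_zero]) (by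
      rintro (_ | _) xs ⟨_ | ⟨_ | _, g⟩, k⟩
      all_goals simp only [Bool.not_true, Bool.not_false, Bool.true_or, Bool.false_or,
        List.headD_cons, List.headD_nil, Bool.and_true, Bool.and_false]
      · exact .mono (.seq (.condFalse rfl .skip) (.seq .assign .assign)) (by decide)
      · exact .mono (.seq (.condFalse rfl .skip) (.seq .assign .assign)) (by decide)
      · exact .mono (.seq (.condFalse rfl .skip) (.seq .assign .assign)) (by decide)
      · exact .mono (.seq (.condTrue (fun h => nomatch h) (.condFalse rfl .assign))
          (.seq .assign .assign)) (by decide)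
      · exact .mono (.seq (.condTrue (fun h => nomatch h) (.condFalse rfl .assign))
          (.seq .assign .assign)) (by decide)
      · exact .mono (.seq (.condTrue (fun h => nomatch h) (.condTrue (fun h => nomatch h) .skip))
          (.seq .assign .assign)) (by decide))
    ((List.finRange n).map fun a => decide (a ∈ A))
    ((List.finRange n).map fun a => decide (a ∈ B), true)
  have e : ∀ l : List (Fin n), ∀ k, (l.map fun a => decide (a ∈ A)).foldl
      (fun (g : List Bool × Bool) b => (g.1.tail, g.2 && (!b || g.1.headD false)))
      (l.map fun a => decide (a ∈ B), k) =
      ([], k && l.all fun a => decide (a ∈ A → a ∈ B)) := by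
    intro l
    induction l with
    | nil => simp
    | cons a l ih =>
      intro k
      simp only [List.map_cons, List.foldl_cons, List.tail_cons, List.headD_cons, ih]
      simp [Bool.and_assoc, imp_iff_not_or]
  have e' : ((List.finRange n).all fun a => decide (a ∈ A → a ∈ B)) = decide (A ⊆ B) := by
    rw [Bool.eq_iff_iff]
    simp [Finset.subset_iff, imp_iff_not_or]
  rw [e, e', Bool.true_and] at h
  simp only [List.map_map, List.length_map, List.length_finRange] at h
  refine .mono (.seq .assign h) ?_
  simp only [Expr.cost]
  omega

/-! ### The enumeration program -/

/-- The variables `4`, `5`, `6` become the element, the implications and the families of the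
instance in variable `0`, and variable `7` becomes the list of the complement of the element. -/
def initProg : Prog :=
  .assign 4 (.hd (.tl (.tl (.var 0)))) ;; .assign 5 (.hd (.tl (.var 0))) ;;
  .assign 6 (.hd (.tl (.tl (.tl (.var 0))))) ;; .assign 1 (.hd (.var 0)) ;;
  .assign 0 (.var 4) ;;
  .loop (.var 0) (.assign 0 (.tl (.var 0)) ;; .assign 1 (.tl (.var 1))) ;;
  .assign 1 (.tl (.var 1)) ;;
  .loop (.var 1) (.assign 2 (.cons (.cons .nil .nil) (.var 2)) ;; .assign 1 (.tl (.var 1))) ;;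
  .assign 2 (.cons .nil (.var 2)) ;; .assign 0 (.var 4) ;;
  .loop (.var 0) (.assign 2 (.cons (.cons .nil .nil) (.var 2)) ;; .assign 0 (.tl (.var 0))) ;;
  .assign 7 (.cons (.var 2) .nil) ;; .assign 2 .nil

/-- Intersects the sets listed in variable `12` with the first set listed in variable `11`, and
pushes the results onto variable `8`. -/
def interLoop : Prog :=
  .loop (.var 12)
    (.assign 0 (.hd (.var 12)) ;; .assign 1 (.hd (.var 11)) ;; interProg ;;
    .assign 8 (.cons (.var 3) (.var 8)) ;; .assign 3 .nil ;; .assign 12 (.tl (.var 12)))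

/-- Intersects the sets listed in variable `7` with those listed in variable `11`, and pushes the
results onto variable `8`. -/
def famLoop : Prog :=
  .loop (.var 11) (.assign 12 (.var 7) ;; interLoop ;; .assign 11 (.tl (.var 11)))

/-- Runs `famLoop` on the families listed in variable `10` that belong to the members of the set in
variable `9`. -/
def ancLoop : Prog :=
  .loop (.var 10)
    (.assign 0 (.hd (.hd (.var 10))) ;; .assign 1 (.var 9) ;; memberProg ;;
    .cond (.var 2) (.assign 2 .nil ;; .assign 11 (.tl (.hd (.var 10))) ;; famLoop) .skip ;;
    .assign 10 (.tl (.var 10)))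

/-- Refines the candidates listed in variable `7` by the implications listed in variable `5`. -/
def baseLoop : Prog :=
  .loop (.var 5)
    (.assign 0 (.var 4) ;; .assign 1 (.tl (.hd (.var 5))) ;; memberProg ;;
    .cond (.var 2)
      (.assign 2 .nil ;; .assign 9 (.hd (.hd (.var 5))) ;; .assign 10 (.var 6) ;; ancLoop ;;
      .assign 7 (.var 8) ;; .assign 8 .nil ;; .assign 9 .nil) .skip ;;
    .assign 5 (.tl (.var 5)))

/-- Resets variable `11` if the set in variable `9` is contained in a set listed in
variable `10`. -/
def domLoop : Prog :=
  .loop (.var 10)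
    (.assign 0 (.var 9) ;; .assign 1 (.hd (.var 10)) ;; subsetProg ;;
    .cond (.var 2) (.assign 11 .nil) .skip ;; .assign 2 .nil ;; .assign 10 (.tl (.var 10)))

/-- Pushes the maximal ones of the sets listed in variable `7` onto variable `8`. -/
def maxLoop : Prog :=
  .loop (.var 7)
    (.assign 9 (.hd (.var 7)) ;; .assign 7 (.tl (.var 7)) ;; .assign 11 (.cons .nil .nil) ;;
    .assign 10 (.var 7) ;; domLoop ;; .assign 10 (.var 8) ;; domLoop ;;
    .cond (.var 11) (.assign 8 (.cons (.var 9) (.var 8))) .skip ;;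
    .assign 9 .nil ;; .assign 11 .nil)

/-- The program that enumerates `irr(x)` from the families of the ancestors of `x`. -/
def enumProg : Prog :=
  initProg ;; baseLoop ;; maxLoop ;; .assign 0 (.var 8)

/-! ### Functions on lists of sets that the loops compute -/

variable {n : ℕ}

/-- The intersections of the members of `L` with the sets that `la` lists for members of `A`. -/
def extend (la : List (Fin n × List (Finset (Fin n)))) (A : Finset (Fin n))
    (L : List (Finset (Fin n))) : List (Finset (Fin n)) :=
  la.reverse.flatMap fun q => if q.1 ∈ A then
    q.2.reverse.flatMap fun M => L.reverse.flatMap fun C => [C ∩ M] else []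

/-- The refinement of the candidates `L` by the implication `i`. -/
def refineBy (x : Fin n) (la : List (Fin n × List (Finset (Fin n))))
    (L : List (Finset (Fin n))) (i : Implication (Fin n)) : List (Finset (Fin n)) :=
  if x ∈ i.conclusion then extend la i.premise L else L

/-- The encoding of an implication. -/
def encImp (i : Implication (Fin n)) : Data :=
  .cons (Data.ofSet i.premise) (Data.ofSet i.conclusion)

/-- The encoding of an ancestor with its family. -/
def encAnc (q : Fin n × List (Finset (Fin n))) : Data :=
  .cons (Data.ofNat q.1) (Data.ofSets q.2)

theorem replicate_eq_ofSet (x : Fin n) :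
    Data.ofList (List.replicate x (.cons .nil .nil) ++
      .nil :: List.replicate (n - x - 1) (.cons .nil .nil)) =
      Data.ofSet (Finset.univ \ {x}) := by
  have := x.2
  rw [Data.ofSet]
  congr 1
  apply List.ext_getElem
  · simp
    omega
  · intro i h₁ h₂
    rcases lt_trichotomy i x with h | h | h
    · have : (⟨i, by simpa using h₂⟩ : Fin n) ≠ x := by
        simp only [ne_eq, Fin.ext_iff]; omega
      simp [List.getElem_append_left, h, this, Data.ofBool]
    · subst h
      simp [Data.ofBool]
    · obtain ⟨j, rfl⟩ := Nat.exists_eq_add_of_lt h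
      simp [List.getElem_append_right, Fin.ext_iff, Data.ofBool, Nat.add_assoc]

/-- The tail of `nil` is `nil`, in agreement with truncated subtraction. -/
theorem ofNat_foldl_tl : ∀ m k : ℕ,
    (List.replicate m Data.nil).foldl (fun v _ => v.tl) (Data.ofNat k) = Data.ofNat (k - m)
  | 0, k => rfl
  | m + 1, 0 => by
    rw [List.replicate_succ, List.foldl_cons]
    exact (ofNat_foldl_tl m 0).trans (by simp)
  | m + 1, k + 1 => by
    rw [List.replicate_succ, List.foldl_cons, Nat.add_sub_add_right]
    exact ofNat_foldl_tl m k

theorem initProg_spec (x : Fin n) (li la : Data) :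
    HaltsIn initProg (storeOf (Data.ofList [Data.ofNat n, li, Data.ofNat x, la] ::
        List.replicate 12 .nil)) (30 * n + 60)
      (storeOf [.nil, .nil, .nil, .nil, Data.ofNat x, li, la,
        Data.ofSets [Finset.univ \ {x}], .nil, .nil, .nil, .nil, .nil]) := by
  have hx := x.2
  -- The vector is built from its last entry backwards: `n - x - 1` ones, the zero at `x`, then `x`
  -- ones. The counter `n - x - 1` comes from `x` tails of the unary `n` and one more.
  have h₁ := HaltsIn.loop_foldl (i := 0) (b := 6)
    (p := .assign 0 (.tl (.var 0)) ;; .assign 1 (.tl (.var 1))) id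
    (fun xs (v : Data) => storeOf [Data.ofList xs, v, .nil, .nil, Data.ofNat x, li, la,
        .nil, .nil, .nil, .nil, .nil, .nil]) (fun v _ => v.tl)
    (by simp [storeOf_zero]) (fun x xs g => .seq .assign .assign)
    (List.replicate x .nil) (Data.ofNat n)
  have h₂ := HaltsIn.loop_foldl (i := 1) (b := 9)
    (p := .assign 2 (.cons (.cons .nil .nil) (.var 2)) ;; .assign 1 (.tl (.var 1))) id
    (fun xs (v : List Data) => storeOf [.nil, Data.ofList xs, Data.ofList v, .nil, Data.ofNat x,
        li, la, .nil, .nil, .nil, .nil, .nil, .nil]) (fun v _ => .cons .nil .nil :: v)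
    (by simp [storeOf]) (fun x xs g => .seq .assign .assign)
    (List.replicate (n - x - 1) .nil) []
  have h₃ := HaltsIn.loop_foldl (i := 0) (b := 9)
    (p := .assign 2 (.cons (.cons .nil .nil) (.var 2)) ;; .assign 0 (.tl (.var 0))) id
    (fun xs (v : List Data) => storeOf [Data.ofList xs, .nil, Data.ofList v, .nil, Data.ofNat x,
        li, la, .nil, .nil, .nil, .nil, .nil, .nil]) (fun v _ => .cons .nil .nil :: v)
    (by simp [storeOf_zero]) (fun x xs g => .seq .assign .assign)
    (List.replicate x .nil) (.nil :: List.replicate (n - x - 1) (.cons .nil .nil))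
  rw [ofNat_foldl_tl] at h₁
  rw [List.foldl_flip_cons_eq_append] at h₂ h₃
  simp only [List.map_replicate, List.reverse_replicate, List.append_nil, replicate_eq_ofSet,
    List.length_replicate] at h₁ h₂ h₃
  have h₄ : (Data.ofNat (n - x)).tl = Data.ofNat (n - x - 1) := by
    obtain ⟨m, hm⟩ : ∃ m, n - x = m + 1 := ⟨n - x - 1, by omega⟩
    rw [hm]
    rfl
  have h₅ : HaltsIn (.assign 1 (.tl (.var 1))) (storeOf [.nil, Data.ofNat (n - x), .nil, .nil,
      Data.ofNat x, li, la, .nil, .nil, .nil, .nil, .nil, .nil]) 3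
      (storeOf [.nil, Data.ofNat (n - x - 1), .nil, .nil, Data.ofNat x, li, la,
        .nil, .nil, .nil, .nil, .nil, .nil]) := by
    rw [← h₄]
    exact .assign
  refine .mono (.seq .assign (.seq .assign (.seq .assign (.seq .assign (.seq .assign (.seq h₁
    (.seq h₅ (.seq h₂ (.seq .assign (.seq .assign (.seq h₃ (.seq .assign .assign)))))))))))) ?_
  simp only [Expr.cost]
  omega

/-! ### Effect and cost of the loops -/

section Loops

variable (x li la L A lac : Data)

theorem interLoop_spec (M : Finset (Fin n)) (F : Data) (L : List (Finset (Fin n))) (K : Data)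
    (acc : List (Finset (Fin n))) :
    HaltsIn interLoop (storeOf [.nil, .nil, .nil, .nil, x, li, la, K, Data.ofSets acc, A, lac,
        .cons (Data.ofSet M) F, Data.ofSets L]) (L.length * (26 * n + 25) + 2)
      (storeOf [.nil, .nil, .nil, .nil, x, li, la, K,
        Data.ofSets ((L.reverse.flatMap fun C => [C ∩ M]) ++ acc), A, lac,
        .cons (Data.ofSet M) F, .nil]) :=
  HaltsIn.loop_append (i := 12) (b := 26 * n + 23) Data.ofSet
    (fun xs g => storeOf [.nil, .nil, .nil, .nil, x, li, la, K, Data.ofSets g, A, lac,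
        .cons (Data.ofSet M) F, Data.ofSets xs]) (fun C => [C ∩ M]) L
    (fun _ _ => rfl)
    (fun C _ ys g => .mono (.seq .assign (.seq .assign (.seq (interProg_spec C M _ _ _)
      (.seq .assign (.seq .assign .assign))))) (by simp only [Expr.cost]; omega)) acc

theorem famLoop_spec (F L acc : List (Finset (Fin n))) :
    HaltsIn famLoop (storeOf [.nil, .nil, .nil, .nil, x, li, la, Data.ofSets L, Data.ofSets acc,
        A, lac, Data.ofSets F, .nil]) (F.length * (L.length * (26 * n + 25) + 10) + 2)
      (storeOf [.nil, .nil, .nil, .nil, x, li, la, Data.ofSets L,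
        Data.ofSets ((F.reverse.flatMap fun M => L.reverse.flatMap fun C => [C ∩ M]) ++ acc),
        A, lac, .nil, .nil]) :=
  HaltsIn.loop_append (i := 11) (b := L.length * (26 * n + 25) + 8) Data.ofSet
    (fun xs g => storeOf [.nil, .nil, .nil, .nil, x, li, la, Data.ofSets L, Data.ofSets g,
        A, lac, Data.ofSets xs, .nil]) (fun M => L.reverse.flatMap fun C => [C ∩ M]) F
    (fun _ _ => rfl)
    (fun M _ ys g => .mono (.seq .assign (.seq (interLoop_spec _ _ _ _ _ M _ L _ _) .assign))
      (by simp only [Expr.cost]; omega)) acc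

theorem ancLoop_spec (qs : List (Fin n × List (Finset (Fin n)))) (m : ℕ)
    (hm : ∀ q ∈ qs, q.2.length ≤ m) (B : Finset (Fin n)) (L : List (Finset (Fin n))) :
    HaltsIn ancLoop (storeOf [.nil, .nil, .nil, .nil, x, li, la, Data.ofSets L, .nil,
        Data.ofSet B, Data.ofList (qs.map encAnc), .nil, .nil])
      (qs.length * (m * (L.length * (26 * n + 25) + 10) + 8 * n + 32) + 2)
      (storeOf [.nil, .nil, .nil, .nil, x, li, la, Data.ofSets L, Data.ofSets (extend qs B L),
        Data.ofSet B, .nil, .nil, .nil]) := by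
  have h := HaltsIn.loop_append (i := 10)
    (b := m * (L.length * (26 * n + 25) + 10) + 8 * n + 30) encAnc
    (fun xs g => storeOf [.nil, .nil, .nil, .nil, x, li, la, Data.ofSets L, Data.ofSets g,
        Data.ofSet B, Data.ofList (xs.map encAnc), .nil, .nil])
    (fun q => if q.1 ∈ B then
      q.2.reverse.flatMap fun M => L.reverse.flatMap fun C => [C ∩ M] else []) qs
    (p := .assign 0 (.hd (.hd (.var 10))) ;; .assign 1 (.var 9) ;; memberProg ;;
    .cond (.var 2) (.assign 2 .nil ;; .assign 11 (.tl (.hd (.var 10))) ;; famLoop) .skip ;;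
    .assign 10 (.tl (.var 10)))
    (fun _ _ => rfl) (by
      intro q hq ys g
      have hF := Nat.mul_le_mul_right (L.length * (26 * n + 25) + 10) (hm q hq)
      have h₁ := memberProg_spec q.1 B .nil [.nil, x, li, la, Data.ofSets L, Data.ofSets g,
        Data.ofSet B, Data.ofList ((q :: ys).map encAnc), .nil, .nil]
      by_cases hB : q.1 ∈ B
      · rw [decide_eq_true hB] at h₁
        rw [if_pos hB]
        exact .mono (.seq .assign (.seq .assign (.seq h₁ (.seq (.condTrue (fun h => nomatch h)
          (.seq .assign (.seq .assign (famLoop_spec _ _ _ _ _ q.2 L g)))) .assign))))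
          (by simp only [Expr.cost]; omega)
      · rw [decide_eq_false hB] at h₁
        rw [if_neg hB]
        exact .mono (.seq .assign (.seq .assign (.seq h₁ (.seq (.condFalse rfl .skip) .assign))))
          (by simp only [Expr.cost]; omega)) []
  rw [List.append_nil] at h
  exact h

end Loops

/-- The growth factor of one refinement is the number of pairs of an ancestor and a set of its
family. -/
theorem length_extend_le (qs : List (Fin n × List (Finset (Fin n)))) {m : ℕ}
    (hm : ∀ q ∈ qs, q.2.length ≤ m) (A : Finset (Fin n)) (L : List (Finset (Fin n))) :
    (extend qs A L).length ≤ qs.length * m * L.length := by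
  rw [extend, List.length_flatMap]
  refine (List.sum_le_card_nsmul _ (m * L.length) ?_).trans (by simp [Nat.mul_assoc])
  intro s hs
  obtain ⟨q, hq, rfl⟩ := List.mem_map.1 hs
  split_ifs
  · simpa using Nat.mul_le_mul_right _ (hm q (List.mem_reverse.1 hq))
  · simp

/-- The potential `g.length * s ^ r`, with `r` the number of remaining implications that conclude
`x`, never increases: such an implication multiplies the length by at most `s`, and the others
change nothing. As `0 < s`, it bounds the current length by `ℓ`, hence the cost of every turn. -/
theorem baseLoop_spec (x : Fin n) (qs : List (Fin n × List (Finset (Fin n)))) (m : ℕ)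
    (hm : ∀ q ∈ qs, q.2.length ≤ m) (li : List (Implication (Fin n))) (s : ℕ) (hs : 0 < s)
    (hqs : qs.length * m ≤ s) (L : List (Finset (Fin n))) (ℓ : ℕ)
    (hL : L.length * s ^ li.countP (fun i => x ∈ i.conclusion) ≤ ℓ) :
    HaltsIn baseLoop (storeOf [.nil, .nil, .nil, .nil, Data.ofNat x, Data.ofList (li.map encImp),
        Data.ofList (qs.map encAnc), Data.ofSets L, .nil, .nil, .nil, .nil, .nil])
      (li.length * (qs.length * (m * (ℓ * (26 * n + 25) + 10) + 8 * n + 32) + 8 * n + 42) + 2)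
      (storeOf [.nil, .nil, .nil, .nil, Data.ofNat x, .nil,
        Data.ofList (qs.map encAnc), Data.ofSets (li.foldl (refineBy x qs) L), .nil, .nil, .nil,
        .nil, .nil]) ∧ (li.foldl (refineBy x qs) L).length ≤ ℓ := by
  obtain ⟨g', h, hg', hl⟩ := HaltsIn.loop_list (i := 5)
    (b := qs.length * (m * (ℓ * (26 * n + 25) + 10) + 8 * n + 32) + 8 * n + 40) encImp
    (fun xs g => storeOf [.nil, .nil, .nil, .nil, Data.ofNat x, Data.ofList (xs.map encImp),
        Data.ofList (qs.map encAnc), Data.ofSets g, .nil, .nil, .nil, .nil, .nil])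
    (P := fun xs g => xs.foldl (refineBy x qs) g = li.foldl (refineBy x qs) L ∧
      g.length * s ^ xs.countP (fun i => x ∈ i.conclusion) ≤ ℓ)
    (p := .assign 0 (.var 4) ;; .assign 1 (.tl (.hd (.var 5))) ;; memberProg ;;
    .cond (.var 2)
      (.assign 2 .nil ;; .assign 9 (.hd (.hd (.var 5))) ;; .assign 10 (.var 6) ;; ancLoop ;;
      .assign 7 (.var 8) ;; .assign 8 .nil ;; .assign 9 .nil) .skip ;;
    .assign 5 (.tl (.var 5)))
    (fun _ _ => rfl) (by
      rintro i xs g ⟨hg, hl⟩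
      refine ⟨refineBy x qs g i, ?_, hg, ?_⟩
      · have hgl : g.length ≤ ℓ := (Nat.le_mul_of_pos_right _ (pow_pos hs _)).trans hl
        have hb : qs.length * (m * (g.length * (26 * n + 25) + 10) + 8 * n + 32) ≤
            qs.length * (m * (ℓ * (26 * n + 25) + 10) + 8 * n + 32) := by gcongr
        have h₁ := memberProg_spec x i.conclusion .nil [.nil, Data.ofNat x,
          Data.ofList ((i :: xs).map encImp),
          Data.ofList (qs.map encAnc), Data.ofSets g, .nil, .nil, .nil, .nil, .nil]
        by_cases hx : x ∈ i.conclusion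
        · rw [decide_eq_true hx] at h₁
          rw [refineBy, if_pos hx]
          exact .mono (.seq .assign (.seq .assign (.seq h₁ (.seq (.condTrue (fun h => nomatch h)
            (.seq .assign (.seq .assign (.seq .assign (.seq
              (ancLoop_spec _ _ _ qs m hm i.premise g)
              (.seq .assign (.seq .assign .assign))))))) .assign))))
            (by simp only [Expr.cost]; omega)
        · rw [decide_eq_false hx] at h₁
          rw [refineBy, if_neg hx]
          exact .mono (.seq .assign (.seq .assign (.seq h₁ (.seq (.condFalse rfl .skip) .assign))))
            (by simp only [Expr.cost]; omega)
      · rw [List.countP_cons] at hl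
        rw [refineBy]
        split_ifs with hx
        · simp only [hx, decide_true, if_true, pow_succ] at hl
          refine le_trans ?_ hl
          rw [mul_comm (s ^ _) s, ← mul_assoc]
          refine Nat.mul_le_mul_right _ ((length_extend_le qs hm _ _).trans ?_)
          rw [mul_comm g.length]
          exact Nat.mul_le_mul_right _ hqs
        · simpa [hx] using hl) li L ⟨rfl, hL⟩
  simp only [List.foldl_nil] at hg'
  subst hg'
  exact ⟨h, by simpa using hl⟩

theorem domLoop_spec (x li la L O : Data) (C : Finset (Fin n)) (D : List (Finset (Fin n)))
    (k : Bool) :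
    HaltsIn domLoop (storeOf [.nil, .nil, .nil, .nil, x, li, la, L, O, Data.ofSet C,
        Data.ofSets D, Data.ofBool k, .nil]) (D.length * (16 * n + 25) + 2)
      (storeOf [.nil, .nil, .nil, .nil, x, li, la, L, O, Data.ofSet C, .nil,
        Data.ofBool (k && D.all fun B => !decide (C ⊆ B)), .nil]) := by
  have h := HaltsIn.loop_foldl (i := 10) (b := 16 * n + 23) Data.ofSet
    (fun xs k => storeOf [.nil, .nil, .nil, .nil, x, li, la, L, O, Data.ofSet C,
        Data.ofSets xs, Data.ofBool k, .nil]) (fun k B => k && !decide (C ⊆ B))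
    (p := .assign 0 (.var 9) ;; .assign 1 (.hd (.var 10)) ;; subsetProg ;;
    .cond (.var 2) (.assign 11 .nil) .skip ;; .assign 2 .nil ;; .assign 10 (.tl (.var 10)))
    (fun _ _ => rfl) (by
      intro B xs k
      have h₁ := subsetProg_spec C B .nil [.nil, x, li, la, L, O, Data.ofSet C,
        Data.ofSets (B :: xs), Data.ofBool k, .nil]
      by_cases hB : C ⊆ B
      · rw [decide_eq_true hB] at h₁ ⊢
        rw [Bool.not_true, Bool.and_false]
        exact .mono (.seq .assign (.seq .assign (.seq h₁ (.seq (.condTrue (fun h => nomatch h)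
          .assign) (.seq .assign .assign))))) (by simp only [Expr.cost]; omega)
      · rw [decide_eq_false hB] at h₁ ⊢
        rw [Bool.not_false, Bool.and_true]
        exact .mono (.seq .assign (.seq .assign (.seq h₁ (.seq (.condFalse rfl
          .skip) (.seq .assign .assign))))) (by simp only [Expr.cost]; omega)) D k
  have e : ∀ (D : List (Finset (Fin n))) (k : Bool),
      D.foldl (fun k B => k && !decide (C ⊆ B)) k = (k && D.all fun B => !decide (C ⊆ B)) := by
    intro D
    induction D with
    | nil => simp
    | cons B D ih => intro k; rw [List.foldl_cons, ih, List.all_cons, Bool.and_assoc]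
  rw [e] at h
  exact h

/-- A candidate is kept when it lies in no later candidate and in no kept one; of equal candidates
only the last can survive. By the invariant no kept set lies in a remaining candidate, so a newly
kept set is incomparable to the earlier ones. The bound on `xs.length + O.length` pays for both
scans together. -/
theorem maxLoop_spec (x la : Data) (L : List (Finset (Fin n))) :
    ∃ O : List (Finset (Fin n)),
      HaltsIn maxLoop (storeOf [.nil, .nil, .nil, .nil, x, .nil, la, Data.ofSets L, .nil, .nil,
          .nil, .nil, .nil]) (L.length * (L.length * (16 * n + 25) + 40) + 2)
        (storeOf [.nil, .nil, .nil, .nil, x, .nil, la, .nil, Data.ofSets O, .nil, .nil, .nil,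
          .nil]) ∧
      O.Pairwise (fun A B => ¬ A ⊆ B ∧ ¬ B ⊆ A) ∧ O ⊆ L ∧ ∀ A ∈ L, ∃ B ∈ O, A ⊆ B := by
  obtain ⟨O, h, hO⟩ := HaltsIn.loop_list (i := 7) (b := L.length * (16 * n + 25) + 38) Data.ofSet
    (fun xs O => storeOf [.nil, .nil, .nil, .nil, x, .nil, la, Data.ofSets xs, Data.ofSets O, .nil,
          .nil, .nil, .nil])
    (P := fun xs O => O.Pairwise (fun A B => ¬ A ⊆ B ∧ ¬ B ⊆ A) ∧ xs ++ O ⊆ L ∧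
      (∀ A ∈ L, ∃ B ∈ xs ++ O, A ⊆ B) ∧ (∀ A ∈ O, ∀ B ∈ xs, ¬ A ⊆ B) ∧
      xs.length + O.length ≤ L.length)
    (p := .assign 9 (.hd (.var 7)) ;; .assign 7 (.tl (.var 7)) ;; .assign 11 (.cons .nil .nil) ;;
    .assign 10 (.var 7) ;; domLoop ;; .assign 10 (.var 8) ;; domLoop ;;
    .cond (.var 11) (.assign 8 (.cons (.var 9) (.var 8))) .skip ;;
    .assign 9 .nil ;; .assign 11 .nil)
    (fun _ _ => rfl) (by
      rintro C xs O ⟨hp, hsub, hdom, hrest, hlen⟩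
      have hb : xs.length * (16 * n + 25) + O.length * (16 * n + 25) ≤
          L.length * (16 * n + 25) := by
        rw [← add_mul]
        simp only [List.length_cons] at hlen
        gcongr
        omega
      have h₁ := domLoop_spec x .nil la (Data.ofSets xs) (Data.ofSets O) C xs true
      have h₂ := domLoop_spec x .nil la (Data.ofSets xs) (Data.ofSets O) C O
        (true && xs.all fun B => !decide (C ⊆ B))
      simp only [List.length_cons, List.cons_append, List.cons_subset, List.mem_cons] at *
      cases hk : (true && xs.all fun B => !decide (C ⊆ B)) && O.all fun B => !decide (C ⊆ B) with
      | false =>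
        rw [hk] at h₂
        refine ⟨O, .mono (.seq .assign (.seq .assign (.seq .assign (.seq .assign (.seq h₁
          (.seq .assign (.seq h₂ (.seq (.condFalse rfl .skip) (.seq .assign .assign)))))))))
          (by simp only [Expr.cost]; omega), hp, hsub.2, ?_, fun A hA B hB => hrest A hA B (.inr hB),
          by omega⟩
        -- A dropped set lies in a surviving one, which takes over everything it dominated.
        have hC : ∃ B ∈ xs ++ O, C ⊆ B := by
          by_contra! hC
          simp only [List.mem_append] at hC
          simp [List.all_eq_false] at hk
          grind
        intro A hA
        obtain ⟨B, rfl | hB, hAB⟩ := hdom A hA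
        · exact hC.imp fun D hD => ⟨hD.1, hAB.trans hD.2⟩
        · exact ⟨B, hB, hAB⟩
      | true =>
        rw [hk] at h₂
        refine ⟨C :: O, .mono (.seq .assign (.seq .assign (.seq .assign (.seq .assign (.seq h₁
          (.seq .assign (.seq h₂ (.seq (.condTrue (fun h => nomatch h) .assign)
          (.seq .assign .assign))))))))) (by simp only [Expr.cost]; omega), ?_, ?_, ?_, ?_, ?_⟩
        · simp at hk
          exact List.pairwise_cons.2 ⟨fun B hB => ⟨hk.2 B hB, hrest B hB C (.inl rfl)⟩, hp⟩
        · grind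
        · intro A hA
          obtain ⟨B, hB, hAB⟩ := hdom A hA
          exact ⟨B, by grind, hAB⟩
        · simp at hk
          grind
        · simp only [List.length_cons]
          omega) L [] ⟨.nil, by simp, fun A hA => ⟨A, by simpa using hA, subset_rfl⟩, by simp, by simp⟩
  exact ⟨O, h, hO.1, by simpa using hO.2.1, by simpa using hO.2.2.1⟩

/-! ### Irreducible closed sets -/

/-- Implications concluding `x` do not fire inside `D`, and the other conclusions are unaffected by
the removal of `x`. -/
theorem closedFor_sdiff_singleton {α : Type*} [DecidableEq α] {Γ : ImpBase α} {x : α}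
    {D : Finset α} (hD : ClosedFor Γ D)
    (h : ∀ i ∈ Γ, x ∈ i.conclusion → ¬ i.premise ⊆ D) : ClosedFor Γ (D \ {x}) := by
  intro i hi hp
  have hp' := hp.trans Finset.sdiff_subset
  by_cases hx : x ∈ i.conclusion
  · exact absurd hp' (h i hi hx)
  · exact Finset.subset_sdiff.2 ⟨hD i hi hp', Finset.disjoint_singleton_right.2 hx⟩

section Irreducibles

variable {α : Type*} [Fintype α] {Γ : ImpBase α} {x : α}

theorem mem_irr {M : Finset α} :
    M ∈ irr Γ x ↔ Maximal (fun C => ClosedFor Γ C ∧ x ∉ C) M := by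
  simp [irr]

theorem exists_irr_superset {C : Finset α} (hC : ClosedFor Γ C) (hx : x ∉ C) :
    ∃ M ∈ irr Γ x, C ⊆ M := by
  obtain ⟨M, hCM, hM⟩ := (Set.toFinite {C | ClosedFor Γ C ∧ x ∉ C}).exists_le_maximal ⟨hC, hx⟩
  exact ⟨M, mem_irr.2 hM, hCM⟩

/-- Acyclicity excludes `x` itself from the premise. Thus the input provides `irr(t)` for every `t`
that a refinement may choose. -/
theorem premise_subset_anc (hΓ : Acyclic Γ) {i : Implication α} (hi : i ∈ Γ)
    (hx : x ∈ i.conclusion) : i.premise ⊆ anc Γ x := by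
  intro a ha
  have harc : Arc Γ a x := ⟨i, hi, ha, hx⟩
  simp only [anc, Finset.mem_filter, Finset.mem_univ, true_and]
  exact ⟨fun h => by subst h; exact hΓ a (.single harc), .single harc⟩

variable [DecidableEq α]

/-- The vertices outside `M` already form a transversal, which contains a minimal one. -/
theorem exists_minTransversal_disjoint {M : Finset α} {E : Finset (Finset α)}
    (h : ∀ A ∈ E, ¬ A ⊆ M) : ∃ T, IsMinTransversal E T ∧ Disjoint T M := by
  have hW : IsTransversal E (E.biUnion id \ M) := by
    refine ⟨Finset.sdiff_subset, fun A hA => ?_⟩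
    obtain ⟨a, haA, haM⟩ := Finset.not_subset.1 (h A hA)
    exact ⟨a, Finset.mem_inter.2 ⟨Finset.mem_sdiff.2
      ⟨Finset.mem_biUnion.2 ⟨A, hA, haA⟩, haM⟩, haA⟩⟩
  obtain ⟨T, hTW, hT⟩ := (Set.toFinite {T | IsTransversal E T}).exists_le_minimal hW
  exact ⟨T, hT, Finset.disjoint_of_subset_left hTW Finset.sdiff_disjoint⟩

theorem exists_selection_of_mem_irr {M : Finset α} (hM : M ∈ irr Γ x) :
    ∃ (T : Finset α) (S : Finset (Finset α)), IsMinTransversal (premisesOf Γ x) T ∧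
      IsSelection Γ T S ∧ M = interFam S \ {x} := by
  obtain ⟨⟨hMc, hxM⟩, hmax⟩ := mem_irr.1 hM
  obtain ⟨T, hT, hTM⟩ := exists_minTransversal_disjoint (M := M) (E := premisesOf Γ x) (by
    intro A hA hAM
    simp only [premisesOf, Finset.mem_image, Finset.mem_filter] at hA
    obtain ⟨i, ⟨hi, hxi⟩, rfl⟩ := hA
    exact hxM (hMc i hi hAM hxi))
  have hsel : ∀ t, ∃ N, t ∈ T → N ∈ irr Γ t ∧ M ⊆ N := by
    intro t
    by_cases ht : t ∈ T
    · obtain ⟨N, hN, hMN⟩ := exists_irr_superset hMc (Finset.disjoint_left.1 hTM ht)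
      exact ⟨N, fun _ => ⟨hN, hMN⟩⟩
    -- A dummy value: only the choices for members of `T` enter the selection.
    · exact ⟨∅, fun h => absurd h ht⟩
  choose f hf using hsel
  refine ⟨T, T.image f, hT, ⟨f, fun t ht => (hf t ht).1, rfl⟩, ?_⟩
  have hmem : ∀ a, a ∈ interFam (T.image f) ↔ ∀ t ∈ T, a ∈ f t := by simp [interFam]
  have hsub : M ⊆ interFam (T.image f) \ {x} := fun a ha => Finset.mem_sdiff.2
    ⟨(hmem a).2 fun t ht => (hf t ht).2 ha, fun h => hxM (Finset.mem_singleton.1 h ▸ ha)⟩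
  -- By maximality of `M` it remains to see that the larger set is closed. Each premise of `x` meets
  -- `T` in some `t`, and `t ∉ f t`, so the intersection contains no such premise.
  refine hsub.antisymm (hmax ⟨closedFor_sdiff_singleton ?_ ?_, by simp⟩ hsub)
  · exact fun i hi hp a ha => (hmem a).2 fun t ht =>
      (mem_irr.1 (hf t ht).1).prop.1 i hi (fun b hb => (hmem b).1 (hp hb) t ht) ha
  · intro i hi hxi hp
    obtain ⟨t, ht⟩ := hT.prop.2 i.premise
      (Finset.mem_image_of_mem _ (Finset.mem_filter.2 ⟨hi, hxi⟩))
    rw [Finset.mem_inter] at ht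
    exact (mem_irr.1 (hf t ht.1).1).prop.2 ((hmem t).1 (hp ht.2) t ht.1)

end Irreducibles

/-! ### Correctness and running time of the enumeration -/

variable {Γ : ImpBase (Fin n)} {x : Fin n} {la : List (Fin n × List (Finset (Fin n)))}

theorem mem_extend {A D : Finset (Fin n)} {L : List (Finset (Fin n))} :
    D ∈ extend la A L ↔ ∃ q ∈ la, q.1 ∈ A ∧ ∃ M ∈ q.2, ∃ C ∈ L, D = C ∩ M := by
  simp only [extend, List.mem_flatMap, List.mem_reverse]
  refine exists_congr fun q => and_congr_right fun _ => ?_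
  split_ifs with h <;> simp [h]

/-- An intermediate candidate need not be closed, since unprocessed implications may still force
`x`. The invariant therefore carries a closed `D` that may contain `x` but contains no processed
premise of `x`. -/
theorem exists_closed_of_mem_candidates (hla : ∀ q ∈ la, Lists q.2 (irr Γ q.1)) :
    ∀ (li ps : List (Implication (Fin n))) (L : List (Finset (Fin n))),
      (∀ C ∈ L, ∃ D, ClosedFor Γ D ∧ C = D \ {x} ∧
        ∀ i ∈ ps, x ∈ i.conclusion → ¬ i.premise ⊆ D) →
      ∀ C ∈ li.foldl (refineBy x la) L, ∃ D, ClosedFor Γ D ∧ C = D \ {x} ∧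
        ∀ i ∈ li ++ ps, x ∈ i.conclusion → ¬ i.premise ⊆ D
  | [], ps, L, h => by simpa using h
  | i :: li, ps, L, h => by
    intro C hC
    obtain ⟨D, hD, hCD, hi⟩ := exists_closed_of_mem_candidates hla li (i :: ps)
      (refineBy x la L i) (by
        intro C hC
        rw [refineBy] at hC
        split_ifs at hC with hx
        · obtain ⟨q, hq, hqi, M, hM, C', hC', rfl⟩ := mem_extend.1 hC
          obtain ⟨D, hD, rfl, hps⟩ := h C' hC'
          rw [← List.mem_toFinset, (hla q hq).2] at hM
          have hM := (mem_irr.1 hM).prop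
          refine ⟨D ∩ M, fun j hj hp => ?_, by rw [Finset.sdiff_inter_right_comm], ?_⟩
          · rw [Finset.subset_inter_iff] at hp ⊢
            exact ⟨hD j hj hp.1, hM.1 j hj hp.2⟩
          · intro j hj hxj hp
            rw [Finset.subset_inter_iff] at hp
            rcases List.mem_cons.1 hj with rfl | hj
            -- The new premise contains `q.1`, which `M` omits as a member of `irr(q.1)`.
            · exact hM.2 (hp.2 hqi)
            · exact hps j hj hxj hp.1
        · obtain ⟨D, hD, hCD, hps⟩ := h C hC
          refine ⟨D, hD, hCD, fun j hj hxj => ?_⟩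
          rcases List.mem_cons.1 hj with rfl | hj
          · exact absurd hxj hx
          · exact hps j hj hxj) C hC
    refine ⟨D, hD, hCD, fun j hj => hi j ?_⟩
    simp only [List.cons_append, List.mem_cons, List.mem_append] at hj ⊢
    tauto

/-- Being closed without `x`, `M` omits some `t` of each premise of `x` and so lies in some `K ∈
irr(t)`. The refinement contains `C ∩ K`, which still includes `M`. -/
theorem exists_superset_mem_candidates (hΓ : Acyclic Γ) (hla : ∀ q ∈ la, Lists q.2 (irr Γ q.1))
    (hanc : (la.map Prod.fst).toFinset = anc Γ x) {M : Finset (Fin n)} (hM : M ∈ irr Γ x) :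
    ∀ (li : List (Implication (Fin n))) (L : List (Finset (Fin n))), (∀ i ∈ li, i ∈ Γ) →
      (∃ C ∈ L, M ⊆ C) → ∃ C ∈ li.foldl (refineBy x la) L, M ⊆ C
  | [], _, _, h => h
  | i :: li, L, hli, h => by
    refine exists_superset_mem_candidates hΓ hla hanc hM li _
      (fun j hj => hli j (List.mem_cons_of_mem _ hj)) ?_
    obtain ⟨C, hC, hMC⟩ := h
    rw [refineBy]
    split_ifs with hx
    · have hi := hli i List.mem_cons_self
      obtain ⟨hMc, hxM⟩ := (mem_irr.1 hM).prop
      obtain ⟨t, hti, htM⟩ := Finset.not_subset.1 fun h => hxM (hMc i hi h hx)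
      have ht := premise_subset_anc hΓ hi hx hti
      rw [← hanc, List.mem_toFinset, List.mem_map] at ht
      obtain ⟨q, hq, rfl⟩ := ht
      obtain ⟨K, hK, hMK⟩ := exists_irr_superset hMc htM
      rw [← (hla q hq).2, List.mem_toFinset] at hK
      exact ⟨C ∩ K, mem_extend.2 ⟨q, hq, hti, K, hK, C, hC, rfl⟩, Finset.subset_inter hMC hMK⟩
    · exact ⟨C, hC, hMC⟩

/-- A member of `irr(x)` lies in a kept candidate and equals it by maximality. Conversely a kept
candidate lies in a member of `irr(x)`, itself kept, and incomparability of kept sets makes them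
equal. -/
theorem lists_irr_of_maximal {L O : List (Finset (Fin n))}
    (hclosed : ∀ C ∈ L, ClosedFor Γ C ∧ x ∉ C) (hirr : ∀ M ∈ irr Γ x, ∃ C ∈ L, M ⊆ C)
    (hO : O.Pairwise (fun A B => ¬ A ⊆ B ∧ ¬ B ⊆ A)) (hOL : O ⊆ L)
    (hdom : ∀ A ∈ L, ∃ B ∈ O, A ⊆ B) : Lists O (irr Γ x) := by
  have hmem : ∀ M ∈ irr Γ x, M ∈ O := by
    intro M hM
    obtain ⟨C, hC, hMC⟩ := hirr M hM
    obtain ⟨B, hB, hCB⟩ := hdom C hC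
    have := (mem_irr.1 hM).eq_of_le (hclosed B (hOL hB)) (hMC.trans hCB)
    exact this ▸ hB
  refine ⟨hO.imp fun h => fun e => h.1 (e ▸ subset_rfl), Finset.ext fun C => ?_⟩
  rw [List.mem_toFinset]
  refine ⟨fun hC => ?_, hmem C⟩
  obtain ⟨M, hM, hCM⟩ := exists_irr_superset (hclosed C (hOL hC)).1 (hclosed C (hOL hC)).2
  by_cases hne : C = M
  · exact hne ▸ hM
  -- Symmetry of the relation makes the order of the two sets in the list irrelevant.
  · have : Std.Symm fun A B : Finset (Fin n) => ¬ A ⊆ B ∧ ¬ B ⊆ A := ⟨fun _ _ h => And.symm h⟩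
    exact absurd hCM (hO.forall hC (hmem M hM) hne).1

theorem update_nil_eq_storeOf (d : Data) (m : ℕ) :
    Function.update (fun _ => Data.nil) 0 d = storeOf (d :: List.replicate m .nil) := by
  funext i
  rcases i with _ | i
  · rfl
  · rw [storeOf_succ, storeOf, Function.update_of_ne (by simp), List.getD_eq_getElem?_getD,
      List.getElem?_replicate]
    split_ifs <;> rfl

/-- The three summands account for `initProg` with the final copy, `baseLoop` and `maxLoop`. -/
theorem enumProg_spec (hΓ : Acyclic Γ) {d : Data} (hd : EncodesInput Γ x d) {N : ℕ}
    (hN : N = inputSize Γ x) : ∃ (t : ℕ) (o : Data), RunsTo enumProg d t o ∧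
      EncodesFamily (irr Γ x) o ∧
      t ≤ 30 * n + 65 +
        (N * (N * (N * ((N * N) ^ cdeg Γ * (26 * n + 25) + 10) + 8 * n + 32) + 8 * n + 42) + 2) +
        ((N * N) ^ cdeg Γ * ((N * N) ^ cdeg Γ * (16 * n + 25) + 40) + 2) := by
  obtain ⟨li, la, hli, hanc, hla, rfl⟩ := hd
  rw [inputSize, Fintype.card_fin] at hN
  have hn : 0 < n := x.pos
  have hNpos : 0 < N * N := Nat.mul_pos (by omega) (by omega)
  have hliN : li.length ≤ N := by
    rw [← List.toFinset_card_of_nodup hli.1, hli.2]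
    omega
  have hlaN : la.length ≤ N := by
    rw [← List.length_map (f := Prod.fst), ← List.toFinset_card_of_nodup hanc.1, hanc.2]
    exact (Finset.card_le_univ _).trans (by rw [Fintype.card_fin]; omega)
  have hfam : ∀ q ∈ la, q.2.length ≤ N := by
    intro q hq
    rw [← List.toFinset_card_of_nodup (hla q hq).1, (hla q hq).2]
    have hqa : q.1 ∈ anc Γ x := by
      rw [← hanc.2, List.mem_toFinset]
      exact List.mem_map_of_mem hq
    have := Finset.card_le_card (Finset.subset_biUnion_of_mem (irr Γ) hqa)
    omega
  have hcount : li.countP (fun i => x ∈ i.conclusion) ≤ cdeg Γ := by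
    refine le_trans (le_of_eq ?_) (Finset.le_sup (f := cdegAt Γ) (Finset.mem_univ x))
    rw [cdegAt, ← hli.2, List.countP_eq_length_filter,
      ← List.toFinset_card_of_nodup (hli.1.filter _)]
    congr 1
    ext i
    simp
  -- At most `N` ancestors with at most `N` sets each give the growth factor `N * N`, starting from
  -- a single candidate.
  obtain ⟨hbase, hlen⟩ := baseLoop_spec x la N hfam li (N * N) hNpos
    (Nat.mul_le_mul_right N hlaN) [Finset.univ \ {x}] ((N * N) ^ cdeg Γ)
    (by simpa using Nat.pow_le_pow_right hNpos hcount)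
  obtain ⟨O, hmax, hO, hOL, hdom⟩ := maxLoop_spec (Data.ofNat x) (Data.ofList (la.map encAnc))
    (li.foldl (refineBy x la) [Finset.univ \ {x}])
  have hinit := initProg_spec x (Data.ofList (li.map encImp)) (Data.ofList (la.map encAnc))
  obtain ⟨t, ht, hrun⟩ := HaltsIn.seq hinit (.seq hbase (.seq hmax (.assign (i := 0) (e := .var 8))))
  rw [← update_nil_eq_storeOf _ 12] at hrun
  refine ⟨t, Data.ofSets O, ⟨_, hrun, rfl⟩, ⟨O, lists_irr_of_maximal ?_ ?_ hO hOL hdom, rfl⟩, ?_⟩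
  · intro C hC
    obtain ⟨D, hD, rfl, hi⟩ := exists_closed_of_mem_candidates hla li [] [Finset.univ \ {x}]
      (by simpa using ⟨Finset.univ, fun _ _ _ => Finset.subset_univ _, rfl⟩) C hC
    refine ⟨closedFor_sdiff_singleton hD fun i hiΓ => hi i ?_, by simp⟩
    rw [List.append_nil, ← List.mem_toFinset, hli.2]
    exact hiΓ
  · intro M hM
    refine exists_superset_mem_candidates hΓ hla hanc.2 hM li _
      (fun i hi => by rwa [← hli.2, List.mem_toFinset]) ⟨_, List.mem_singleton_self _, ?_⟩
    exact Finset.subset_sdiff.2 ⟨Finset.subset_univ _,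
      Finset.disjoint_singleton_right.2 (mem_irr.1 hM).prop.2⟩
  · have h₁ : li.length * (la.length * (N * ((N * N) ^ cdeg Γ * (26 * n + 25) + 10) + 8 * n + 32) +
        8 * n + 42) ≤
        N * (N * (N * ((N * N) ^ cdeg Γ * (26 * n + 25) + 10) + 8 * n + 32) + 8 * n + 42) := by
      gcongr
    have h₂ := Nat.mul_le_mul hlen (Nat.add_le_add_right
      (Nat.mul_le_mul_right (16 * n + 25) hlen) 40)
    simp only [Expr.cost] at ht
    omega

/-- With `ℓ = (N * N) ^ k`, every term is at most a constant times `N ^ 4 * ℓ ^ 2 = N ^ (4 + 4 *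
k)`. The constants add up to 331; the value 400 is generous and serves as both factor and exponent.
-/
theorem enumProg_bound {n N k : ℕ} (hn : 0 < n) (hnN : n ≤ N) :
    30 * n + 65 +
        (N * (N * (N * ((N * N) ^ k * (26 * n + 25) + 10) + 8 * n + 32) + 8 * n + 42) + 2) +
        ((N * N) ^ k * ((N * N) ^ k * (16 * n + 25) + 40) + 2) ≤
      400 * N ^ (400 * max 1 k) := by
  have hN : 1 ≤ N := by omega
  have hℓ : 1 ≤ (N * N) ^ k := Nat.one_le_pow _ _ (Nat.mul_pos hN hN)
  -- Lower-order terms are padded by factors that are at least 1, so that few distinct monomials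
  -- remain.
  calc _ ≤ 30 * N + 65 * N + (N * (N * (N * ((N * N) ^ k * (26 * N + 25 * N) + 10 * (N * (N * N) ^ k))
            + 8 * (N * N * (N * N) ^ k) + 32 * (N * N * (N * N) ^ k))
            + 8 * (N * N * N * (N * N) ^ k) + 42 * (N * N * N * (N * N) ^ k)) + 2 * N) +
        ((N * N) ^ k * ((N * N) ^ k * (16 * N + 25 * N) + 40 * (N * (N * N) ^ k)) + 2 * N) := by
        have h₁ : 1 ≤ N * (N * N) ^ k := Nat.mul_pos hN hℓ
        have h₂ : 1 ≤ N * N * (N * N) ^ k := Nat.mul_pos (Nat.mul_pos hN hN) hℓ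
        have h₃ : 1 ≤ N * N * N * (N * N) ^ k := Nat.mul_pos (Nat.mul_pos (Nat.mul_pos hN hN) hN) hℓ
        have h₄ : N ≤ N * N * (N * N) ^ k := by
          rw [Nat.mul_assoc]; exact Nat.le_mul_of_pos_right _ h₁
        have h₅ : N ≤ N * N * N * (N * N) ^ k := by
          rw [Nat.mul_assoc, Nat.mul_assoc, ← Nat.mul_assoc N N (_ ^ _)]
          exact Nat.le_mul_of_pos_right _ h₂
        gcongr <;> omega
    _ = 99 * N + 151 * (N ^ 4 * (N * N) ^ k) + 81 * (N * ((N * N) ^ k) ^ 2) := by ring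
    _ ≤ 99 * (N ^ 4 * ((N * N) ^ k) ^ 2) + 151 * (N ^ 4 * ((N * N) ^ k) ^ 2) +
        81 * (N ^ 4 * ((N * N) ^ k) ^ 2) := by
        generalize (N * N) ^ k = ℓ at hℓ
        have h₁ : N ≤ N ^ 4 := Nat.le_self_pow (by norm_num) N
        gcongr
        · exact h₁.trans (Nat.le_mul_of_pos_right _ (pow_pos hℓ 2))
        · exact Nat.le_self_pow (by norm_num) _
    _ = 331 * N ^ (4 + 4 * k) := by ring
    _ ≤ 400 * N ^ (400 * max 1 k) := by
        gcongr
        · norm_num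
        · omega

end ACG

theorem mainTheorem7 :
    (∃ (p : ACG.Prog) (c : ℕ), ACG.SolvesWithin p (fun N k => c * N ^ (c * max 1 k))) ∧
    (∀ {α : Type*} [Fintype α] [DecidableEq α] (Γ : ACG.ImpBase α) (x : α) (M : Finset α),
      ACG.Acyclic Γ → M ∈ ACG.irr Γ x →
        ∃ (T : Finset α) (S : Finset (Finset α)),
          ACG.IsMinTransversal (ACG.premisesOf Γ x) T ∧
          ACG.IsSelection Γ T S ∧
          M = ACG.interFam S \ {x}) := by
  refine ⟨⟨ACG.enumProg, 400, fun n Γ x d hΓ hd => ?_⟩,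
    fun Γ x M _ hM => ACG.exists_selection_of_mem_irr hM⟩
  obtain ⟨t, o, hrun, ho, ht⟩ := ACG.enumProg_spec hΓ hd rfl
  refine ⟨t, o, hrun, ho, ht.trans (ACG.enumProg_bound x.pos ?_)⟩
  rw [ACG.inputSize, Fintype.card_fin]
  omega
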